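/- **Setting.** Let $H_S=\sum_i \epsilon_i |\epsilon_i\rangle\langle\epsilon_i|$ be the Hamiltonian of a finite-dimensional quantum system $S$ (energies real, possibly degenerate). The weight $W$ has Hilbert space $L^2(\mathbb R)$, its Hamiltonian $H_W$ is multiplication by the energy variable $E$, and $\Delta_W$ is the generator of the displacements $\Gamma_a=e^{-ia\Delta_W}$, $(\Gamma_a\psi)(E)=\psi(E-a)$, so that $\Gamma_a^\dagger H_W\Gamma_a=H_W+a$. Let $S=e^{-iH_S\otimes\Delta_W}=\sum_i|\epsilon_i\rangle\langle\epsilon_i|\otimes\Gamma_{\epsilon_i}$, let $V_S$ be a unitary on the system, $U=S^\dagger (V_S\otimes 1) S$, and $W_S=H_S-V_S^\dagger H_SV_S$. For density operators $\rho_S$ and $\rho_W$ of the system and the weight, the final state of the weight is $\rho_W'=\mathrm{Tr}_S[U(\rho_S\otimes\rho_W)U^\dagger]$. The energy distribution of a weight state $\rho$ is the probability measure $B\mapsto \mathrm{Tr}[\rho\,1_B(H_W)]$ on $\mathbb R$. Denote by $\sigma_E^{(i)},\sigma_E^{(f)}\in[0,\infty]$ the standard deviations of the energy distributions of $\rho_W$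 and $\rho_W'$ (equal to $\infty$ if there is no finite second moment), by $\Delta E_W$ the mean of the energy distribution of $\rho_W'$ minus that of $\rho_W$, and by $\Delta\sigma_W^2$ the variance of the energy distribution of $\rho_W'$ minus that of $\rho_W$. Write $\langle A\rangle_{\rho_S}=\mathrm{Tr}[A\rho_S]$ and $\mathrm{Var}_{\rho_S}[A]=\langle A^2\rangle_{\rho_S}-\langle A\rangle_{\rho_S}^2$. **Corollary (incoherent work extraction).** Suppose that $[W_S,H_S]=0$, or that $\rho_S$ is incoherent, i.e. $[\rho_S,H_S]=0$. Then $\Delta E_W$ and $\Delta\sigma_W^2$ do not depend on the state of the weight. Precisely: 1. If the energy distribution of $\rho_W$ has a finite first moment, then so has that of $\rho_W'$, and $\Delta E_W=\langle W_S\rangle_{\rho_S}$. 2. If the energy distribution of $\rho_W$ has a finite second moment, then so has that of $\rho_W'$, and $\Delta\sigma_W^2=\mathrm{Var}_{\rho_S}[W_S]$. 3. There is no constraint on the initial dispersion: for every real $s>0$ there is a weight state $\rho_W$ with finite second moment of the energy, with $\sigma_E^{(i)}=s$, and with these same values of $\Delta E_W$ and $\Delta\sigma_W^2$. 4. For every weight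 state $\rho_W$ the final dispersion satisfies $\sigma_E^{(f)}\ge\sqrt{\mathrm{Var}_{\rho_S}[W_S]}$, i.e. the final energy variance is at least $\mathrm{Var}_{\rho_S}[W_S]$. -/

import Mathlib

open MeasureTheory ProbabilityTheory
open scoped ENNReal ComplexOrder

noncomputable section

/-! ### Density operators -/

theorem enorm_sq_eq_tsum {E : Type*} [NormedAddCommGroup E] [InnerProductSpace ℂ E] {κ : Type*}
    (b : HilbertBasis κ ℂ E) (x : E) :
    ‖x‖ₑ ^ 2 = ∑' k, ‖inner ℂ (b k) x‖ₑ ^ 2 := by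
  have h := b.hasSum_inner_mul_inner x x
  have h2 : HasSum (fun k => ‖inner ℂ (b k) x‖ ^ 2) (‖x‖ ^ 2) := by
    have h3 := Complex.hasSum_re h
    have h4 : (inner ℂ x x : ℂ).re = ‖x‖ ^ 2 := by
      rw [← inner_self_eq_norm_sq (𝕜 := ℂ)]; rfl
    rw [h4] at h3
    refine h3.congr_fun ?_ |> fun h => h
    intro k
    rw [← inner_conj_symm x (b k), ← Complex.normSq_eq_conj_mul_self, Complex.ofReal_re,
      Complex.normSq_eq_norm_sq]
  have h5 := ENNReal.ofReal_tsum_of_nonneg (fun k => by positivity) h2.summable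
  rw [h2.tsum_eq] at h5
  simpa [← ofReal_norm, ENNReal.ofReal_pow] using h5

section Density

variable {E : Type*} [NormedAddCommGroup E] [InnerProductSpace ℂ E] [CompleteSpace E]

/-- A fixed Hilbert basis of a complex Hilbert space, as a set of vectors. -/
def hilbertBasisSet (E : Type*) [NormedAddCommGroup E] [InnerProductSpace ℂ E]
    [CompleteSpace E] : Set E :=
  (exists_hilbertBasis ℂ E).choose

/-- The trace `∑ₑ ⟪e, T e⟫ ∈ [0, ∞]` of a positive bounded operator `T`. For positive operators
it does not depend on the Hilbert basis, see `posTrace_eq`. -/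
def posTrace (T : E →L[ℂ] E) : ℝ≥0∞ :=
  ∑' e : hilbertBasisSet E, ENNReal.ofReal (inner ℂ (e : E) (T e)).re

/-- A density operator: positive, trace class, of trace one. -/
structure IsDensityOperator (ρ : E →L[ℂ] E) : Prop where
  isPositive : ρ.IsPositive
  trace_eq_one : posTrace ρ = 1

/-- The Hilbert-Schmidt norm is the same for an operator and its adjoint, in any two bases. -/
theorem tsum_enorm_sq_comm {κ κ' : Type*} (b : HilbertBasis κ ℂ E) (c : HilbertBasis κ' ℂ E)
    (A : E →L[ℂ] E) :
    ∑' k, ‖A (b k)‖ₑ ^ 2 = ∑' l, ‖ContinuousLinearMap.adjoint A (c l)‖ₑ ^ 2 := by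
  simp_rw [enorm_sq_eq_tsum c (A _), enorm_sq_eq_tsum b (ContinuousLinearMap.adjoint A _)]
  rw [ENNReal.tsum_comm]
  refine tsum_congr fun l => tsum_congr fun k => ?_
  rw [ContinuousLinearMap.adjoint_inner_right, ← inner_conj_symm]
  rw [← ofReal_norm, ← ofReal_norm, RCLike.norm_conj]

/-- The positive square root of a positive operator. -/
def opSqrt (ρ : E →L[ℂ] E) : E →L[ℂ] E := CFC.sqrt ρ

theorem opSqrt_adjoint (ρ : E →L[ℂ] E) :
    ContinuousLinearMap.adjoint (opSqrt ρ) = opSqrt ρ :=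
  (IsSelfAdjoint.of_nonneg (CFC.sqrt_nonneg ρ)).star_eq

theorem inner_conj_eq {ρ : E →L[ℂ] E} (hρ : ρ.IsPositive) (P : E →L[ℂ] E) (x : E) :
    ENNReal.ofReal (inner ℂ x ((ContinuousLinearMap.adjoint P ∘L ρ ∘L P) x)).re
      = ‖(opSqrt ρ ∘L P) x‖ₑ ^ 2 := by
  have h : opSqrt ρ * opSqrt ρ = ρ :=
    CFC.sqrt_mul_sqrt_self ρ ((ContinuousLinearMap.nonneg_iff_isPositive ρ).2 hρ)
  have h1 : ρ (P x) = opSqrt ρ (opSqrt ρ (P x)) := by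
    conv_lhs => rw [← h]
    rfl
  simp only [ContinuousLinearMap.comp_apply, ContinuousLinearMap.adjoint_inner_right]
  rw [h1, ← ContinuousLinearMap.adjoint_inner_left, opSqrt_adjoint]
  have h4 : (inner ℂ (opSqrt ρ (P x)) (opSqrt ρ (P x)) : ℂ).re = ‖opSqrt ρ (P x)‖ ^ 2 := by
    rw [← inner_self_eq_norm_sq (𝕜 := ℂ)]; rfl
  rw [h4, ENNReal.ofReal_pow (norm_nonneg _), ofReal_norm]

theorem hilbertBasisSet_spec :
    ∃ b : HilbertBasis (hilbertBasisSet E) ℂ E, ⇑b = ((↑) : hilbertBasisSet E → E) :=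
  (exists_hilbertBasis ℂ E).choose_spec

/-- The trace of a positive operator can be computed in any Hilbert basis. -/
theorem posTrace_eq {κ : Type*} (b : HilbertBasis κ ℂ E) {T : E →L[ℂ] E} (hT : T.IsPositive) :
    posTrace T = ∑' k, ENNReal.ofReal (inner ℂ (b k) (T (b k))).re := by
  obtain ⟨c, hc⟩ := hilbertBasisSet_spec (E := E)
  have key : ∀ x, ENNReal.ofReal (inner ℂ x (T x)).re = ‖opSqrt T x‖ₑ ^ 2 := by
    intro x
    have h := inner_conj_eq hT (ContinuousLinearMap.id ℂ E) x
    simpa only [ContinuousLinearMap.adjoint_id, ContinuousLinearMap.id_comp,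
      ContinuousLinearMap.comp_id] using h
  unfold posTrace
  simp_rw [key]
  have h := tsum_enorm_sq_comm c b (opSqrt T)
  rw [hc, opSqrt_adjoint] at h
  exact h

end Density

/-! ### The quantum weight, in the energy representation -/

/-- The Hilbert space `L²(ℝ)` of the weight. The variable is the energy `E`, so that the
Hamiltonian `H_W` is multiplication by `E`. -/
abbrev WeightSpace : Type := Lp ℂ 2 (volume : Measure ℝ)

/-- The displacement operator `Γ_a = exp (-i a Δ_W)`, `(Γ_a ψ)(E) = ψ (E - a)`; it satisfies
`Γ_a† H_W Γ_a = H_W + a`. -/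
def displacement (a : ℝ) : WeightSpace →L[ℂ] WeightSpace :=
  (Lp.compMeasurePreservingₗᵢ ℂ (fun x : ℝ => x - a)
    (measurePreserving_sub_right volume a)).toContinuousLinearMap

/-- Multiplication by the indicator function of `B`, as a map. -/
def indicatorFun (B : Set ℝ) (hB : MeasurableSet B) (f : WeightSpace) : WeightSpace :=
  ((Lp.memLp f).indicator hB).toLp _

theorem indicatorFun_coe (B : Set ℝ) (hB : MeasurableSet B) (f : WeightSpace) :
    indicatorFun B hB f =ᵐ[volume] B.indicator f :=
  MemLp.coeFn_toLp _

theorem indicatorFun_add (B : Set ℝ) (hB : MeasurableSet B) (f g : WeightSpace) :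
    indicatorFun B hB (f + g) = indicatorFun B hB f + indicatorFun B hB g := by
  apply Lp.ext
  filter_upwards [indicatorFun_coe B hB (f + g), indicatorFun_coe B hB f,
    indicatorFun_coe B hB g, Lp.coeFn_add f g,
    Lp.coeFn_add (indicatorFun B hB f) (indicatorFun B hB g)] with x h1 h2 h3 h4 h5
  rw [h1, h5, Pi.add_apply, h2, h3]
  by_cases h : x ∈ B <;> simp only [h, Set.indicator_of_mem, Set.indicator_of_notMem,
    not_false_eq_true, h4, Pi.add_apply, add_zero]

theorem indicatorFun_smul (B : Set ℝ) (hB : MeasurableSet B) (c : ℂ) (f : WeightSpace) :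
    indicatorFun B hB (c • f) = c • indicatorFun B hB f := by
  apply Lp.ext
  filter_upwards [indicatorFun_coe B hB (c • f), indicatorFun_coe B hB f,
    Lp.coeFn_smul c f, Lp.coeFn_smul c (indicatorFun B hB f)] with x h1 h2 h3 h4
  rw [h1, h4, Pi.smul_apply, h2]
  by_cases h : x ∈ B <;> simp only [h, Set.indicator_of_mem, Set.indicator_of_notMem,
    not_false_eq_true, h3, Pi.smul_apply, smul_zero]

theorem norm_indicatorFun_le (B : Set ℝ) (hB : MeasurableSet B) (f : WeightSpace) :
    ‖indicatorFun B hB f‖ ≤ 1 * ‖f‖ := by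
  rw [one_mul]
  refine Lp.norm_le_norm_of_ae_le ?_
  filter_upwards [indicatorFun_coe B hB f] with x hx
  rw [hx]
  exact norm_indicator_le_norm_self _ _

/-- The spectral projection `1_B(H_W)`: multiplication by the indicator function of `B`. -/
def energyProj (B : Set ℝ) (hB : MeasurableSet B) : WeightSpace →L[ℂ] WeightSpace :=
  LinearMap.mkContinuous
    { toFun := indicatorFun B hB
      map_add' := indicatorFun_add B hB
      map_smul' := indicatorFun_smul B hB } 1
    (norm_indicatorFun_le B hB)

/-- The energy distribution of a weight state `ρ`, i.e. the measure with density
`f(E) = ⟨E|ρ|E⟩ = ∑ₑ |(√ρ e)(E)|²`. By `energyDist_apply` it is the Born rule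
`B ↦ Tr[1_B(H_W) ρ 1_B(H_W)] = Tr[ρ 1_B(H_W)]`. -/
def energyDist (ρ : WeightSpace →L[ℂ] WeightSpace) : Measure ℝ :=
  Measure.sum fun e : hilbertBasisSet WeightSpace =>
    volume.withDensity fun x => ‖(opSqrt ρ (e : WeightSpace) : WeightSpace) x‖ₑ ^ 2

theorem enorm_energyProj_sq (B : Set ℝ) (hB : MeasurableSet B) (f : WeightSpace) :
    ‖energyProj B hB f‖ₑ ^ 2 = ∫⁻ x in B, ‖f x‖ₑ ^ 2 := by
  have h1 : ‖energyProj B hB f‖ₑ = eLpNorm (B.indicator f) 2 volume := by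
    change ‖((Lp.memLp f).indicator hB).toLp _‖ₑ = _
    rw [Lp.enorm_toLp]
  rw [h1, eLpNorm_indicator_eq_eLpNorm_restrict hB,
    eLpNorm_eq_lintegral_rpow_enorm_toReal (by norm_num) (by norm_num)]
  simp only [ENNReal.toReal_ofNat]
  rw [← ENNReal.rpow_natCast, ← ENNReal.rpow_mul]
  norm_num

theorem energyProj_adjoint (B : Set ℝ) (hB : MeasurableSet B) :
    ContinuousLinearMap.adjoint (energyProj B hB) = energyProj B hB := by
  symm
  rw [ContinuousLinearMap.eq_adjoint_iff]
  intro f g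
  rw [L2.inner_def, L2.inner_def]
  refine integral_congr_ae ?_
  filter_upwards [indicatorFun_coe B hB f, indicatorFun_coe B hB g] with x hf hg
  have hf' : (energyProj B hB f : WeightSpace) x = B.indicator f x := hf
  have hg' : (energyProj B hB g : WeightSpace) x = B.indicator g x := hg
  rw [hf', hg']
  by_cases h : x ∈ B <;> simp [h]

/-- The Born rule. -/
theorem energyDist_apply {ρ : WeightSpace →L[ℂ] WeightSpace} (hρ : ρ.IsPositive)
    (B : Set ℝ) (hB : MeasurableSet B) :
    energyDist ρ B = posTrace (energyProj B hB ∘L ρ ∘L energyProj B hB) := by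
  obtain ⟨c, hc⟩ := hilbertBasisSet_spec (E := WeightSpace)
  have h := tsum_enorm_sq_comm c c (opSqrt ρ ∘L energyProj B hB)
  rw [ContinuousLinearMap.adjoint_comp, opSqrt_adjoint, energyProj_adjoint, hc] at h
  have h2 := fun x => inner_conj_eq hρ (energyProj B hB) x
  rw [energyProj_adjoint] at h2
  unfold posTrace
  simp_rw [h2]
  rw [h, energyDist, Measure.sum_apply _ hB]
  refine tsum_congr fun e => ?_
  rw [withDensity_apply _ hB, ContinuousLinearMap.comp_apply, enorm_energyProj_sq]

/-- The mean energy `⟨H_W⟩_ρ` (meaningful when the energy distribution has a first moment). -/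
def meanEnergy (ρ : WeightSpace →L[ℂ] WeightSpace) : ℝ := ∫ x, x ∂(energyDist ρ)

/-- The energy variance `Var_ρ[H_W]` (meaningful when there is a second moment). -/
def varEnergy (ρ : WeightSpace →L[ℂ] WeightSpace) : ℝ := variance id (energyDist ρ)

/-- The energy dispersion `σ_E ∈ [0, ∞]`: the standard deviation of the energy distribution. It is
`∞` when there is no finite second moment. -/
def dispersion (ρ : WeightSpace →L[ℂ] WeightSpace) : ℝ≥0∞ :=
  (evariance id (energyDist ρ)) ^ (1 / 2 : ℝ)

/-! ### The system, in an eigenbasis of its Hamiltonian -/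

section System

variable {ι : Type*} [Fintype ι] [DecidableEq ι]

/-- The Hamiltonian `H_S = ∑ᵢ εᵢ |εᵢ⟩⟨εᵢ|`. Energies may coincide. -/
def sysHam (ε : ι → ℝ) : Matrix ι ι ℂ := Matrix.diagonal fun i => (ε i : ℂ)

/-- The work operator `W_S = H_S - V_S† H_S V_S`. -/
def workOp (ε : ι → ℝ) (V : Matrix ι ι ℂ) : Matrix ι ι ℂ :=
  sysHam ε - V.conjTranspose * sysHam ε * V

/-- A density matrix of the system. -/
structure IsDensityMatrix (ρ : Matrix ι ι ℂ) : Prop where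
  posSemidef : ρ.PosSemidef
  trace_eq_one : ρ.trace = 1

/-- `⟨A⟩_ρ = Tr[A ρ]`, which is real for Hermitian `A` and `ρ`. -/
def sysMean (ρ A : Matrix ι ι ℂ) : ℝ := (A * ρ).trace.re

/-- `Var_ρ[A] = ⟨A²⟩_ρ - ⟨A⟩_ρ²`. -/
def sysVar (ρ A : Matrix ι ι ℂ) : ℝ := sysMean ρ (A * A) - sysMean ρ A ^ 2

/-! ### System and weight -/

/-- The Hilbert space `ℂ^ι ⊗ L²(ℝ)`, as the Hilbert sum of one copy of `L²(ℝ)` for every energy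
eigenstate `i`: the vector `∑ᵢ |εᵢ⟩ ⊗ ψᵢ` is the family `(ψᵢ)`. -/
abbrev JointSpace (ι : Type*) : Type _ := PiLp 2 fun _ : ι => WeightSpace

/-- `⟨εᵢ| ⊗ 1`. -/
def braOp (i : ι) : JointSpace ι →L[ℂ] WeightSpace :=
  PiLp.proj 2 (fun _ : ι => WeightSpace) i

/-- `|εᵢ⟩ ⊗ 1`. -/
def ketOp (i : ι) : WeightSpace →L[ℂ] JointSpace ι :=
  ContinuousLinearMap.adjoint (braOp i)

theorem ketOp_apply (i : ι) (ψ : WeightSpace) : ketOp i ψ = PiLp.single 2 i ψ := by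
  refine ext_inner_right ℂ fun φ => ?_
  rw [ketOp, ContinuousLinearMap.adjoint_inner_left, PiLp.inner_apply,
    Finset.sum_eq_single i]
  · simp [braOp]
  · intro j _ hj
    simp [PiLp.single_eq_of_ne, hj]
  · simp

/-- The operator `A ⊗ T = ∑ᵢⱼ Aᵢⱼ |εᵢ⟩⟨εⱼ| ⊗ T`. -/
def tensorOp (A : Matrix ι ι ℂ) (T : WeightSpace →L[ℂ] WeightSpace) :
    JointSpace ι →L[ℂ] JointSpace ι :=
  ∑ i, ∑ j, A i j • (ketOp i ∘L T ∘L braOp j)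

/-- `S = exp (-i H_S ⊗ Δ_W) = ∑ᵢ |εᵢ⟩⟨εᵢ| ⊗ Γ_{εᵢ}`. -/
def shiftOp (ε : ι → ℝ) : JointSpace ι →L[ℂ] JointSpace ι :=
  ∑ i, ketOp i ∘L displacement (ε i) ∘L braOp i

/-- `U = S† V_S S`. -/
def protocolUnitary (ε : ι → ℝ) (V : Matrix ι ι ℂ) : JointSpace ι →L[ℂ] JointSpace ι :=
  ContinuousLinearMap.adjoint (shiftOp ε) ∘L
    tensorOp V (ContinuousLinearMap.id ℂ WeightSpace) ∘L shiftOp ε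

/-- The partial trace `Tr_S[R] = ∑ᵢ (⟨εᵢ| ⊗ 1) R (|εᵢ⟩ ⊗ 1)`. -/
def partialTraceS (R : JointSpace ι →L[ℂ] JointSpace ι) : WeightSpace →L[ℂ] WeightSpace :=
  ∑ i, braOp i ∘L R ∘L ketOp i

/-- The final state of the weight, `Tr_S[U (ρ_S ⊗ ρ_W) U†]`. -/
def finalWeight (ε : ι → ℝ) (V ρS : Matrix ι ι ℂ) (ρW : WeightSpace →L[ℂ] WeightSpace) :
    WeightSpace →L[ℂ] WeightSpace :=
  partialTraceS (protocolUnitary ε V ∘L tensorOp ρS ρW ∘L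
    ContinuousLinearMap.adjoint (protocolUnitary ε V))

/-- The extracted work `ΔE_W`: the gain of mean energy of the weight. -/
def workGain (ε : ι → ℝ) (V ρS : Matrix ι ι ℂ) (ρW : WeightSpace →L[ℂ] WeightSpace) : ℝ :=
  meanEnergy (finalWeight ε V ρS ρW) - meanEnergy ρW

/-- The gain `Δσ_W²` of the energy variance of the weight. -/
def varianceGain (ε : ι → ℝ) (V ρS : Matrix ι ι ℂ) (ρW : WeightSpace →L[ℂ] WeightSpace) : ℝ :=
  varEnergy (finalWeight ε V ρS ρW) - varEnergy ρW

end System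

end

/-! Everything follows from one identity, `energyDist_finalWeight`: the final energy distribution of
the weight is the initial one convolved with a finitely supported probability measure ν, the work
distribution, which does not involve the weight state. Means and variances add under convolution, so
both gains are moments of ν, and the variance of ν bounds the final variance from below.

To obtain the identity, write `ρS = ∑ v_m v_m†` and `ρW = R R†` with `R = √ρW`. The final state is
then a sum of `T T†`, where `T = ∑ⱼ V_ij v_m(j) Γ_{εⱼ-εᵢ} R` for a final eigenstate i and a
component m. Its energy density is a sum of squared moduli of superpositions of shifted wave
functions. Expanding the squares gives cross terms between j and k proportional to `ρ_jk ∑ᵢ V_ij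
conj(V_ik) g(εᵢ)`. For `εⱼ ≠ εₖ` these vanish (`coherence_mul_sum_eq_zero`): either `ρ_jk = 0`, or
the sum is an off-block entry of `V† g(H_S) V`, which commutes with `H_S` when `W_S` does. What
survives are terms with a common initial energy e, each a copy of the initial density shifted by `e
- εᵢ`.

The same cancellation (`sum_transitionWeight_mul`) shows that ν has total mass `Tr ρS = 1` and that
its first two moments are those of `W_S` in `ρS`. -/

open ContinuousLinearMap (adjoint)

/-! ### Cancellation of coherences in the system -/

section Algebra

variable {ι : Type*} [Fintype ι] [DecidableEq ι]

theorem apply_eq_zero_of_commute_sysHam {ε : ι → ℝ} {A : Matrix ι ι ℂ}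
    (h : Commute A (sysHam ε)) {i j : ι} (hij : ε i ≠ ε j) : A i j = 0 := by
  have h1 := congrFun (congrFun h.eq i) j
  rw [sysHam, Matrix.mul_diagonal, Matrix.diagonal_mul, mul_comm] at h1
  by_contra h0
  exact hij (by exact_mod_cast (mul_right_cancel₀ h0 h1).symm)

/-- A matrix commuting with `H_S` is block diagonal along the energy levels, degenerate or not, and
`g(H_S)` is scalar on each block. -/
theorem commute_diagonal_comp_of_commute_sysHam {ε : ι → ℝ} {A : Matrix ι ι ℂ}
    (h : Commute A (sysHam ε)) (g : ℝ → ℂ) :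
    Commute A (Matrix.diagonal fun i => g (ε i)) := by
  ext i j
  rw [Matrix.mul_diagonal, Matrix.diagonal_mul]
  by_cases hij : ε i = ε j
  · rw [hij, mul_comm]
  · rw [apply_eq_zero_of_commute_sysHam h hij, zero_mul, mul_zero]

/-- The hypothesis says that `V† H V` commutes with `H`. Conjugating by `V` moves the rotation to
the other factor: `V H V†` commutes with `H`, hence with `g(H)`. Conjugating back gives the claim.
-/
theorem commute_conj_diagonal_comp {ε : ι → ℝ} {V : Matrix ι ι ℂ}
    (hV : V ∈ Matrix.unitaryGroup ι ℂ) (h : Commute (workOp ε V) (sysHam ε)) (g : ℝ → ℂ) :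
    Commute (V.conjTranspose * (Matrix.diagonal fun i => g (ε i)) * V) (sysHam ε) := by
  have hV1 : V.conjTranspose * V = 1 := Matrix.mem_unitaryGroup_iff'.1 hV
  have hV2 : V * V.conjTranspose = 1 := Matrix.mem_unitaryGroup_iff.1 hV
  have h1 : Commute (V.conjTranspose * sysHam ε * V) (sysHam ε) := by
    have := (Commute.refl (sysHam ε)).sub_left h
    simpa [workOp] using this
  have conj_comm : ∀ {W A B : Matrix ι ι ℂ}, W * W.conjTranspose = 1 → W.conjTranspose * W = 1 →
      Commute (W.conjTranspose * A * W) B → Commute (W * B * W.conjTranspose) A := by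
    intro W A B hW hW' hc
    have h2 : W * ((W.conjTranspose * A * W) * B) * W.conjTranspose
        = W * (B * (W.conjTranspose * A * W)) * W.conjTranspose := by rw [hc.eq]
    have h3 : W * ((W.conjTranspose * A * W) * B) * W.conjTranspose
        = (W * W.conjTranspose) * A * (W * B * W.conjTranspose) := by simp only [mul_assoc]
    have h4 : W * (B * (W.conjTranspose * A * W)) * W.conjTranspose
        = (W * B * W.conjTranspose) * A * (W * W.conjTranspose) := by simp only [mul_assoc]
    rw [h3, h4, hW, one_mul, mul_one] at h2
    exact h2.symm
  have h2 := commute_diagonal_comp_of_commute_sysHam (conj_comm hV2 hV1 h1) g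
  have h3 := conj_comm (W := V.conjTranspose) (A := sysHam ε)
    (B := Matrix.diagonal fun i => g (ε i)) (by simpa using hV1) (by simpa using hV2)
    (by simpa using h2)
  simpa using h3

/-- Coherences between different energies do not contribute to functions of the final energy. -/
theorem coherence_mul_sum_eq_zero {ε : ι → ℝ} {V : Matrix ι ι ℂ}
    (hV : V ∈ Matrix.unitaryGroup ι ℂ) {ρS : Matrix ι ι ℂ}
    (hinc : Commute (workOp ε V) (sysHam ε) ∨ Commute ρS (sysHam ε)) (g : ℝ → ℂ) {j k : ι}
    (hjk : ε j ≠ ε k) :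
    ρS j k * ∑ i, V i j * star (V i k) * g (ε i) = 0 := by
  rcases hinc with h | h
  · have h1 := apply_eq_zero_of_commute_sysHam (commute_conj_diagonal_comp hV h g) hjk.symm
    rw [Matrix.mul_apply] at h1
    simp only [Matrix.mul_diagonal, Matrix.conjTranspose_apply] at h1
    have h2 : ∑ i, V i j * star (V i k) * g (ε i) = ∑ i, star (V i k) * g (ε i) * V i j :=
      Finset.sum_congr rfl fun i _ => by ring
    rw [h2, h1, mul_zero]
  · rw [apply_eq_zero_of_commute_sysHam h hjk, zero_mul]

/-- The probability that the system, prepared in the mixture of the vectors `v m`, has energy `e`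
before the transformation `V` and is found in the eigenstate `i` afterwards. -/
noncomputable def transitionWeight {n : ℕ} (ε : ι → ℝ) (V : Matrix ι ι ℂ) (v : Fin n → ι → ℂ)
    (i : ι) (e : ℝ) : ℝ :=
  ∑ m, ‖∑ j with ε j = e, V i j * v m j‖ ^ 2

omit [DecidableEq ι] in
theorem transitionWeight_nonneg {n : ℕ} (ε : ι → ℝ) (V : Matrix ι ι ℂ) (v : Fin n → ι → ℂ)
    (i : ι) (e : ℝ) : 0 ≤ transitionWeight ε V v i e :=
  Finset.sum_nonneg fun _ _ => by positivity

theorem ofReal_norm_sum_sq {κ : Type*} (s : Finset κ) (a : κ → ℂ) :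
    ((‖∑ j ∈ s, a j‖ ^ 2 : ℝ) : ℂ) = ∑ j ∈ s, ∑ k ∈ s, a j * star (a k) := by
  rw [← Finset.sum_mul_sum, ← star_sum]
  push_cast
  exact (Complex.mul_conj' _).symm

/-- Expanding the squares in the transition weights produces exactly the pairs j, k of equal energy;
the other pairs on the right cancel in the sum over i. The kernel takes the final energy and the
energies of both legs j and k. Only its values with equal legs matter, so its form elsewhere can be
chosen to suit each application. -/
theorem sum_transitionWeight_mul {n : ℕ} {ε : ι → ℝ} {V : Matrix ι ι ℂ}
    (hV : V ∈ Matrix.unitaryGroup ι ℂ) {ρS : Matrix ι ι ℂ}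
    (hinc : Commute (workOp ε V) (sysHam ε) ∨ Commute ρS (sysHam ε)) {v : Fin n → ι → ℂ}
    (hv : ∀ j k, ρS j k = ∑ m, v m j * star (v m k)) (G : ℝ → ℝ → ℝ → ℂ) :
    ∑ p ∈ Finset.univ ×ˢ Finset.univ.image ε,
        (transitionWeight ε V v p.1 p.2 : ℂ) * G (ε p.1) p.2 p.2
      = ∑ i, ∑ j, ∑ k, V i j * ρS j k * star (V i k) * G (ε i) (ε j) (ε k) := by
  have key : ∀ i, ∑ e ∈ Finset.univ.image ε, (transitionWeight ε V v i e : ℂ) * G (ε i) e e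
      = ∑ j, ∑ k, if ε j = ε k then V i j * ρS j k * star (V i k) * G (ε i) (ε j) (ε k)
          else 0 := by
    intro i
    have h1 : ∀ e, (transitionWeight ε V v i e : ℂ) * G (ε i) e e
        = ∑ j with ε j = e, ∑ k, if ε j = ε k then
            V i j * ρS j k * star (V i k) * G (ε i) (ε j) (ε k) else 0 := by
      intro e
      rw [transitionWeight, Complex.ofReal_sum]
      simp_rw [ofReal_norm_sum_sq]
      rw [Finset.sum_comm, Finset.sum_mul]
      refine Finset.sum_congr rfl fun j hj => ?_
      have hj' : ε j = e := (Finset.mem_filter.1 hj).2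
      rw [← Finset.sum_filter, Finset.sum_comm, Finset.sum_mul]
      have h2 : (Finset.univ.filter fun k => ε j = ε k) = Finset.univ.filter fun k => ε k = e := by
        ext k; simp [hj', eq_comm]
      rw [h2]
      refine Finset.sum_congr rfl fun k hk => ?_
      have hk' : ε k = e := (Finset.mem_filter.1 hk).2
      rw [hj', hk', hv]
      simp only [Finset.mul_sum, Finset.sum_mul]
      refine Finset.sum_congr rfl fun m _ => ?_
      rw [star_mul']
      ring
    simp_rw [h1]
    exact Finset.sum_fiberwise_of_maps_to (fun j _ => Finset.mem_image_of_mem ε (Finset.mem_univ j)) _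
  rw [Finset.sum_product]
  simp_rw [key]
  have comm : ∀ f : ι → ι → ι → ℂ, ∑ i, ∑ j, ∑ k, f i j k = ∑ j, ∑ k, ∑ i, f i j k := by
    intro f
    rw [Finset.sum_comm]
    exact Finset.sum_congr rfl fun j _ => Finset.sum_comm
  -- The sum over i goes innermost: for fixed j, k of different energy only that whole sum vanishes,
  -- not its terms.
  rw [comm, comm fun i j k => V i j * ρS j k * star (V i k) * G (ε i) (ε j) (ε k)]
  refine Finset.sum_congr rfl fun j _ => Finset.sum_congr rfl fun k _ => ?_
  by_cases hjk : ε j = ε k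
  · simp only [hjk, if_true]
  · simp only [hjk, if_false, Finset.sum_const_zero]
    rw [← coherence_mul_sum_eq_zero hV hinc (fun x => G x (ε j) (ε k)) hjk, Finset.mul_sum]
    exact Finset.sum_congr rfl fun i _ => by ring

omit [DecidableEq ι] in
theorem sum_sum_sum_eq_trace (A B R : Matrix ι ι ℂ) :
    ∑ i, ∑ j, ∑ k, A i j * R j k * star (B i k) = (A * R * B.conjTranspose).trace := by
  simp only [Matrix.trace, Matrix.diag, Matrix.mul_apply, Matrix.conjTranspose_apply,
    Finset.sum_mul]
  exact Finset.sum_congr rfl fun i _ => Finset.sum_comm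

/-- Unitarity gives `V W_S = V H_S - H_S V`. This is how energy differences attached to `V` become
the work operator. -/
theorem mul_workOp_apply {ε : ι → ℝ} {V : Matrix ι ι ℂ} (hV : V ∈ Matrix.unitaryGroup ι ℂ)
    (i j : ι) : (V * workOp ε V) i j = V i j * ((ε j - ε i : ℝ) : ℂ) := by
  have hV2 : V * V.conjTranspose = 1 := Matrix.mem_unitaryGroup_iff.1 hV
  have h : V * workOp ε V = V * sysHam ε - sysHam ε * V := by
    rw [workOp, mul_sub, ← mul_assoc, ← mul_assoc, hV2, one_mul]
  rw [h, Matrix.sub_apply, sysHam, Matrix.mul_diagonal, Matrix.diagonal_mul]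
  push_cast
  ring

theorem conjTranspose_workOp (ε : ι → ℝ) (V : Matrix ι ι ℂ) :
    (workOp ε V).conjTranspose = workOp ε V := by
  have h : (sysHam ε).conjTranspose = sysHam ε := by
    rw [sysHam, Matrix.diagonal_conjTranspose]
    congr 1
    ext i
    simp
  simp [workOp, h, mul_assoc]

/-! ### Moments of the work distribution -/

section Moments

variable {n : ℕ} {ε : ι → ℝ} {V : Matrix ι ι ℂ} (hV : V ∈ Matrix.unitaryGroup ι ℂ)
  {ρS : Matrix ι ι ℂ} (hinc : Commute (workOp ε V) (sysHam ε) ∨ Commute ρS (sysHam ε))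
  {v : Fin n → ι → ℂ} (hv : ∀ j k, ρS j k = ∑ m, v m j * star (v m k))
include hV hinc hv

theorem sum_transitionWeight :
    ∑ p ∈ Finset.univ ×ˢ Finset.univ.image ε, transitionWeight ε V v p.1 p.2 = ρS.trace.re := by
  have h := sum_transitionWeight_mul hV hinc hv (fun _ _ _ => 1)
  have hV1 : V.conjTranspose * V = 1 := Matrix.mem_unitaryGroup_iff'.1 hV
  simp only [mul_one] at h
  rw [sum_sum_sum_eq_trace, Matrix.trace_mul_comm, ← mul_assoc, hV1, one_mul] at h
  rw [← h, ← Complex.ofReal_sum, Complex.ofReal_re]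

theorem sum_transitionWeight_mul_work :
    ∑ p ∈ Finset.univ ×ˢ Finset.univ.image ε, transitionWeight ε V v p.1 p.2 * (p.2 - ε p.1)
      = sysMean ρS (workOp ε V) := by
  have h := sum_transitionWeight_mul hV hinc hv (fun x y _ => ((y - x : ℝ) : ℂ))
  have hV1 : V.conjTranspose * V = 1 := Matrix.mem_unitaryGroup_iff'.1 hV
  have h1 : ∀ i j k, V i j * ρS j k * star (V i k) * ((ε j - ε i : ℝ) : ℂ)
      = (V * workOp ε V) i j * ρS j k * star (V i k) := by
    intro i j k
    rw [mul_workOp_apply hV]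
    ring
  simp only [h1] at h
  rw [sum_sum_sum_eq_trace, Matrix.trace_mul_comm, mul_assoc, ← mul_assoc, ← mul_assoc, hV1,
    one_mul] at h
  rw [sysMean, ← h]
  simp only [← Complex.ofReal_mul, ← Complex.ofReal_sum, Complex.ofReal_re]

theorem sum_transitionWeight_mul_work_sq :
    ∑ p ∈ Finset.univ ×ˢ Finset.univ.image ε, transitionWeight ε V v p.1 p.2 * (p.2 - ε p.1) ^ 2
      = sysMean ρS (workOp ε V * workOp ε V) := by
  -- The square is split with one factor on each leg. Each factor then turns its own `V` into `V
  -- W_S`, and the sum becomes the trace of `(V W_S) ρS (V W_S)†`; putting the whole square on one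
  -- leg would not give `V W_S²`.
  have h := sum_transitionWeight_mul hV hinc hv
    (fun x y z => ((y - x : ℝ) : ℂ) * ((z - x : ℝ) : ℂ))
  have hV1 : V.conjTranspose * V = 1 := Matrix.mem_unitaryGroup_iff'.1 hV
  have h1 : ∀ i j k,
      V i j * ρS j k * star (V i k) * (((ε j - ε i : ℝ) : ℂ) * ((ε k - ε i : ℝ) : ℂ))
      = (V * workOp ε V) i j * ρS j k * star ((V * workOp ε V) i k) := by
    intro i j k
    rw [mul_workOp_apply hV, mul_workOp_apply hV, star_mul']
    have : star (((ε k - ε i : ℝ) : ℂ)) = ((ε k - ε i : ℝ) : ℂ) := Complex.conj_ofReal _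
    rw [this]
    ring
  simp only [h1] at h
  rw [sum_sum_sum_eq_trace, Matrix.trace_mul_comm, Matrix.conjTranspose_mul,
    conjTranspose_workOp] at h
  have h2 : workOp ε V * V.conjTranspose * (V * workOp ε V * ρS)
      = workOp ε V * (V.conjTranspose * V) * workOp ε V * ρS := by simp only [mul_assoc]
  rw [h2, hV1, mul_one] at h
  rw [sysMean, ← h]
  simp only [← Complex.ofReal_mul, ← Complex.ofReal_sum, Complex.ofReal_re, sq]

/-- At every energy the interference terms cancel. -/
theorem sum_norm_sum_sq (F : ℝ → ℂ) :
    ∑ i, ∑ m, ‖∑ j, V i j * v m j * F (ε i - ε j)‖ ^ 2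
      = ∑ p ∈ Finset.univ ×ˢ Finset.univ.image ε,
          transitionWeight ε V v p.1 p.2 * ‖F (ε p.1 - p.2)‖ ^ 2 := by
  have h := sum_transitionWeight_mul hV hinc hv (fun x y z => F (x - y) * star (F (x - z)))
  have h1 : ∀ z : ℂ, z * star z = ((‖z‖ ^ 2 : ℝ) : ℂ) := fun z => by
    push_cast
    exact Complex.mul_conj' z
  rw [← Complex.ofReal_inj, Complex.ofReal_sum, Complex.ofReal_sum]
  simp only [h1, ← Complex.ofReal_mul] at h
  rw [h]
  refine Finset.sum_congr rfl fun i _ => ?_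
  rw [Complex.ofReal_sum]
  simp_rw [ofReal_norm_sum_sq]
  rw [Finset.sum_comm]
  refine Finset.sum_congr rfl fun j _ => ?_
  rw [Finset.sum_comm]
  refine Finset.sum_congr rfl fun k _ => ?_
  rw [hv, Finset.mul_sum, Finset.sum_mul, Finset.sum_mul]
  refine Finset.sum_congr rfl fun m _ => ?_
  rw [star_mul', star_mul']
  ring

end Moments

end Algebra

/-! ### Moments of a convolution -/

section Convolution

variable {μ ν : Measure ℝ} [IsProbabilityMeasure μ] [IsProbabilityMeasure ν]

theorem integrable_id_conv (hμ : Integrable id μ) (hν : Integrable id ν) :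
    Integrable id (μ.conv ν) := by
  rw [Measure.conv, integrable_map_measure aestronglyMeasurable_id (by fun_prop)]
  exact (hμ.comp_fst ν).add (hν.comp_snd μ)

theorem integral_id_conv (hμ : Integrable id μ) (hν : Integrable id ν) :
    ∫ x, x ∂(μ.conv ν) = ∫ x, x ∂μ + ∫ x, x ∂ν := by
  rw [Measure.conv, integral_map (by fun_prop) (by fun_prop),
    integral_add (f := fun p : ℝ × ℝ => p.1) (g := fun p : ℝ × ℝ => p.2)
      (hμ.comp_fst ν) (hν.comp_snd μ)]
  congr 1
  · simpa using integral_fun_fst (μ := μ) (ν := ν) (fun x : ℝ => x)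
  · simpa using integral_fun_snd (μ := μ) (ν := ν) (fun x : ℝ => x)

omit [IsProbabilityMeasure μ] in
theorem memLp_two_fst (hμ : MemLp id 2 μ) : MemLp (fun p : ℝ × ℝ => p.1) 2 (μ.prod ν) :=
  hμ.comp_measurePreserving measurePreserving_fst

theorem memLp_two_snd (hν : MemLp id 2 ν) : MemLp (fun p : ℝ × ℝ => p.2) 2 (μ.prod ν) :=
  hν.comp_measurePreserving measurePreserving_snd

/-- The convolution is the law of the sum of two coordinates; as the second is square integrable, it
can be added or subtracted freely. -/
theorem memLp_two_id_conv_iff (hν : MemLp id 2 ν) : MemLp id 2 (μ.conv ν) ↔ MemLp id 2 μ := by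
  rw [Measure.conv, memLp_map_measure_iff aestronglyMeasurable_id (by fun_prop)]
  refine ⟨fun h => ?_, fun h => (memLp_two_fst h).add (memLp_two_snd hν)⟩
  have h1 : MemLp (fun p : ℝ × ℝ => p.1) 2 (μ.prod ν) := by
    have h2 := h.sub (memLp_two_snd (μ := μ) hν)
    refine h2.congr_norm (by fun_prop) (ae_of_all _ fun p => ?_)
    simp
  have h3 : (μ.prod ν).map Prod.fst = μ := measurePreserving_fst.map_eq
  rw [← h3, memLp_map_measure_iff aestronglyMeasurable_id (by fun_prop)]
  exact h1

theorem variance_id_conv (hμ : MemLp id 2 μ) (hν : MemLp id 2 ν) :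
    variance id (μ.conv ν) = variance id μ + variance id ν := by
  rw [Measure.conv, variance_map aemeasurable_id (by fun_prop)]
  have h := IndepFun.variance_add (memLp_two_fst (ν := ν) hμ) (memLp_two_snd (μ := μ) hν)
    (indepFun_prod (X := id) (Y := id) measurable_id measurable_id)
  have h1 : variance (fun p : ℝ × ℝ => p.1) (μ.prod ν) = variance id μ :=
    measurePreserving_fst.variance_fun_comp (f := id) aemeasurable_id
  have h2 : variance (fun p : ℝ × ℝ => p.2) (μ.prod ν) = variance id ν :=
    measurePreserving_snd.variance_fun_comp (f := id) aemeasurable_id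
  rw [h1, h2] at h
  exact h

/-- Without a second moment the left factor makes the extended variance infinite; otherwise
variances add and that of `μ` is dropped. -/
theorem ofReal_variance_le_evariance_conv (hν : MemLp id 2 ν) :
    ENNReal.ofReal (variance id ν) ≤ evariance id (μ.conv ν) := by
  by_cases h : MemLp id 2 (μ.conv ν)
  · rw [← h.ofReal_variance_eq, variance_id_conv ((memLp_two_id_conv_iff hν).1 h) hν]
    exact ENNReal.ofReal_le_ofReal (le_add_of_nonneg_left (variance_nonneg _ _))
  · rw [evariance_eq_top aestronglyMeasurable_id h]
    exact le_top

end Convolution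

/-! ### Finitely supported measures -/

section Discrete

/-- The measure with mass `w p` at the point `a p`, for `p ∈ s`. -/
noncomputable def weightedDirac {κ : Type*} (s : Finset κ) (w a : κ → ℝ) : Measure ℝ :=
  ∑ p ∈ s, ENNReal.ofReal (w p) • Measure.dirac (a p)

instance {κ : Type*} (s : Finset κ) (w a : κ → ℝ) : IsFiniteMeasure (weightedDirac s w a) := by
  constructor
  simp only [weightedDirac, Measure.coe_finsetSum, Finset.sum_apply, Measure.smul_apply,
    measure_univ, smul_eq_mul, mul_one]
  exact ENNReal.sum_lt_top.2 fun p _ => ENNReal.ofReal_lt_top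

variable {κ : Type*} {s : Finset κ} {w : κ → ℝ} (a : κ → ℝ)

theorem isProbabilityMeasure_weightedDirac (hw : ∀ p, 0 ≤ w p) (hs : ∑ p ∈ s, w p = 1) :
    IsProbabilityMeasure (weightedDirac s w a) := by
  constructor
  simp only [weightedDirac, Measure.coe_finsetSum, Finset.sum_apply, Measure.smul_apply,
    measure_univ, smul_eq_mul, mul_one]
  rw [← ENNReal.ofReal_sum_of_nonneg fun p _ => hw p, hs, ENNReal.ofReal_one]

theorem integral_weightedDirac (hw : ∀ p, 0 ≤ w p) (f : ℝ → ℝ) :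
    ∫ x, f x ∂(weightedDirac s w a) = ∑ p ∈ s, w p * f (a p) := by
  rw [weightedDirac, integral_finsetSum_measure]
  · refine Finset.sum_congr rfl fun p _ => ?_
    rw [integral_smul_measure, integral_dirac, ENNReal.toReal_ofReal (hw p), smul_eq_mul]
  · intro p _
    exact (integrable_dirac (by simp)).smul_measure ENNReal.ofReal_ne_top

theorem memLp_id_weightedDirac (s : Finset κ) (w a : κ → ℝ) :
    MemLp id 2 (weightedDirac s w a) := by
  rw [weightedDirac]
  rw [memLp_two_iff_integrable_sq aestronglyMeasurable_id, integrable_finsetSum_measure]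
  intro p _
  exact (integrable_dirac (by simp)).smul_measure ENNReal.ofReal_ne_top

theorem conv_weightedDirac (μ : Measure ℝ) [IsProbabilityMeasure μ] (s : Finset κ)
    (w a : κ → ℝ) :
    μ.conv (weightedDirac s w a)
      = ∑ p ∈ s, ENNReal.ofReal (w p) • μ.map (fun x => x + a p) := by
  ext B hB
  rw [Measure.conv_comm, Measure.conv, Measure.map_apply (by fun_prop) hB,
    Measure.prod_apply (by measurability), weightedDirac, lintegral_finsetSum_measure,
    Measure.coe_finsetSum, Finset.sum_apply]
  refine Finset.sum_congr rfl fun p _ => ?_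
  rw [lintegral_smul_measure, lintegral_dirac, Measure.smul_apply,
    Measure.map_apply (by fun_prop) hB]
  congr 2
  ext x
  simp [add_comm]

end Discrete


/-! ### Traces and energy distributions of sums of `T T†` -/

section Density

/-- Each summand contributes the squared Hilbert-Schmidt norm of `T†`, which equals that of `T`. Any
factorisation of a state can thus replace its square root, which is not explicit for the final
state. -/
theorem posTrace_sum_self_comp_adjoint {E : Type*} [NormedAddCommGroup E]
    [InnerProductSpace ℂ E] [CompleteSpace E] {κ : Type*} (s : Finset κ) (T : κ → E →L[ℂ] E) :
    posTrace (∑ α ∈ s, T α ∘L adjoint (T α))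
      = ∑ α ∈ s, ∑' e : hilbertBasisSet E, ‖T α (e : E)‖ₑ ^ 2 := by
  obtain ⟨c, hc⟩ := hilbertBasisSet_spec (E := E)
  have h : ∀ α, ∑' e : hilbertBasisSet E, ‖T α (e : E)‖ₑ ^ 2
      = ∑' e : hilbertBasisSet E, ‖adjoint (T α) (e : E)‖ₑ ^ 2 := by
    intro α
    have := tsum_enorm_sq_comm c c (T α)
    rwa [hc] at this
  simp_rw [h]
  rw [← Summable.tsum_finsetSum fun _ _ => ENNReal.summable, posTrace]
  refine tsum_congr fun e => ?_
  have h4 : ∀ α, (inner ℂ (e : E) (T α (adjoint (T α) (e : E)))).re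
      = ‖adjoint (T α) (e : E)‖ ^ 2 := fun α => by
    rw [← ContinuousLinearMap.adjoint_inner_left, ← inner_self_eq_norm_sq (𝕜 := ℂ)]; rfl
  simp only [_root_.sum_apply, inner_sum, ContinuousLinearMap.comp_apply, Complex.re_sum, h4]
  rw [ENNReal.ofReal_sum_of_nonneg fun _ _ => by positivity]
  simp_rw [ENNReal.ofReal_pow (norm_nonneg _), ofReal_norm]

theorem opSqrt_comp_adjoint {E : Type*} [NormedAddCommGroup E] [InnerProductSpace ℂ E]
    [CompleteSpace E] {ρ : E →L[ℂ] E} (hρ : ρ.IsPositive) :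
    opSqrt ρ ∘L adjoint (opSqrt ρ) = ρ := by
  rw [opSqrt_adjoint]
  exact CFC.sqrt_mul_sqrt_self ρ ((ContinuousLinearMap.nonneg_iff_isPositive ρ).2 hρ)

theorem isPositive_sum_self_comp_adjoint {E : Type*} [NormedAddCommGroup E]
    [InnerProductSpace ℂ E] [CompleteSpace E] {κ : Type*} (s : Finset κ) (T : κ → E →L[ℂ] E) :
    (∑ α ∈ s, T α ∘L adjoint (T α)).IsPositive := by
  rw [← ContinuousLinearMap.nonneg_iff_isPositive]
  exact Finset.sum_nonneg fun α _ => (ContinuousLinearMap.nonneg_iff_isPositive _).2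
    (ContinuousLinearMap.isPositive_self_comp_adjoint (T α))

theorem comp_sum_self_comp_adjoint_comp {E F : Type*} [NormedAddCommGroup E]
    [InnerProductSpace ℂ E] [CompleteSpace E] [NormedAddCommGroup F] [InnerProductSpace ℂ F]
    [CompleteSpace F] {κ : Type*} (s : Finset κ) (B : F →L[ℂ] E) (U : F →L[ℂ] F)
    (Y : κ → E →L[ℂ] F) :
    B ∘L (U ∘L (∑ α ∈ s, Y α ∘L adjoint (Y α)) ∘L adjoint U) ∘L adjoint B
      = ∑ α ∈ s, (B ∘L U ∘L Y α) ∘L adjoint (B ∘L U ∘L Y α) := by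
  simp only [ContinuousLinearMap.adjoint_comp, ContinuousLinearMap.finsetSum_comp,
    ContinuousLinearMap.comp_finsetSum, ContinuousLinearMap.comp_assoc]

/-- The energy distribution of `∑ₐ Tₐ Tₐ†` has density `∑ₑ ∑ₐ |(Tₐ e)(E)|²`. -/
theorem energyDist_sum_self_comp_adjoint {κ : Type*} (s : Finset κ)
    (T : κ → WeightSpace →L[ℂ] WeightSpace) {B : Set ℝ} (hB : MeasurableSet B) :
    energyDist (∑ α ∈ s, T α ∘L adjoint (T α)) B
      = ∑' e : hilbertBasisSet WeightSpace,
          ∫⁻ x in B, ∑ α ∈ s, ‖(T α (e : WeightSpace) : WeightSpace) x‖ₑ ^ 2 := by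
  rw [energyDist_apply (isPositive_sum_self_comp_adjoint s T) B hB]
  have h : energyProj B hB ∘L (∑ α ∈ s, T α ∘L adjoint (T α)) ∘L energyProj B hB
      = ∑ α ∈ s, (energyProj B hB ∘L T α) ∘L adjoint (energyProj B hB ∘L T α) := by
    simp only [ContinuousLinearMap.adjoint_comp, energyProj_adjoint,
      ContinuousLinearMap.finsetSum_comp, ContinuousLinearMap.comp_finsetSum,
      ContinuousLinearMap.comp_assoc]
  rw [h, posTrace_sum_self_comp_adjoint,
    ← Summable.tsum_finsetSum fun _ _ => ENNReal.summable]
  refine tsum_congr fun e => ?_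
  rw [lintegral_finsetSum' _ fun α _ =>
    (((Lp.aestronglyMeasurable _).enorm.pow_const 2).restrict)]
  exact Finset.sum_congr rfl fun α _ => enorm_energyProj_sq B hB _

theorem energyDist_self_comp_adjoint (T : WeightSpace →L[ℂ] WeightSpace) {B : Set ℝ}
    (hB : MeasurableSet B) :
    energyDist (T ∘L adjoint T) B
      = ∑' e : hilbertBasisSet WeightSpace,
          ∫⁻ x in B, ‖(T (e : WeightSpace) : WeightSpace) x‖ₑ ^ 2 := by
  simpa using energyDist_sum_self_comp_adjoint {()} (fun _ => T) hB

theorem isProbabilityMeasure_energyDist {ρ : WeightSpace →L[ℂ] WeightSpace}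
    (hρ : IsDensityOperator ρ) : IsProbabilityMeasure (energyDist ρ) := by
  constructor
  have h : energyProj Set.univ MeasurableSet.univ = ContinuousLinearMap.id ℂ WeightSpace := by
    ext1 f
    apply Lp.ext
    filter_upwards [indicatorFun_coe Set.univ MeasurableSet.univ f] with x hx
    rw [Set.indicator_univ] at hx
    exact hx
  rw [energyDist_apply hρ.isPositive _ MeasurableSet.univ, h, ContinuousLinearMap.comp_id,
    ContinuousLinearMap.id_comp, hρ.trace_eq_one]

end Density

/-! ### Pure weight states and Gaussian wave packets -/

section PureState

theorem self_comp_adjoint_rankOne {E : Type*} [NormedAddCommGroup E] [InnerProductSpace ℂ E]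
    [CompleteSpace E] {ψ : E} (hψ : ‖ψ‖ = 1) :
    InnerProductSpace.rankOne ℂ ψ ψ ∘L adjoint (InnerProductSpace.rankOne ℂ ψ ψ)
      = InnerProductSpace.rankOne ℂ ψ ψ := by
  rw [InnerProductSpace.adjoint_rankOne]
  exact InnerProductSpace.isIdempotentElem_rankOne_self hψ

theorem tsum_enorm_inner_hilbertBasisSet {E : Type*} [NormedAddCommGroup E]
    [InnerProductSpace ℂ E] [CompleteSpace E] (ψ : E) :
    ∑' e : hilbertBasisSet E, ‖inner ℂ ψ (e : E)‖ₑ ^ 2 = ‖ψ‖ₑ ^ 2 := by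
  obtain ⟨c, hc⟩ := hilbertBasisSet_spec (E := E)
  rw [enorm_sq_eq_tsum c ψ, hc]
  refine tsum_congr fun e => ?_
  rw [← inner_conj_symm, ← ofReal_norm, ← ofReal_norm, RCLike.norm_conj]

theorem isDensityOperator_rankOne {E : Type*} [NormedAddCommGroup E] [InnerProductSpace ℂ E]
    [CompleteSpace E] {ψ : E} (hψ : ‖ψ‖ = 1) :
    IsDensityOperator (InnerProductSpace.rankOne ℂ ψ ψ) where
  isPositive := by
    rw [← self_comp_adjoint_rankOne hψ]
    exact ContinuousLinearMap.isPositive_self_comp_adjoint _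
  trace_eq_one := by
    have h := posTrace_sum_self_comp_adjoint {()}
      (fun _ => InnerProductSpace.rankOne ℂ ψ ψ)
    simp only [Finset.sum_singleton] at h
    rw [self_comp_adjoint_rankOne hψ] at h
    have hψ' : ‖ψ‖ₑ = 1 := by rw [← ofReal_norm, hψ, ENNReal.ofReal_one]
    rw [h]
    simp only [InnerProductSpace.rankOne_apply, enorm_smul, hψ', mul_one]
    rw [tsum_enorm_inner_hilbertBasisSet, hψ', one_pow]

/-- The projection factors as `P P†` with `P e = ⟨ψ, e⟩ ψ`, and Parseval sums the coefficients to
one, leaving `|ψ|²`. -/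
theorem energyDist_rankOne {ψ : WeightSpace} (hψ : ‖ψ‖ = 1) :
    energyDist (InnerProductSpace.rankOne ℂ ψ ψ) = volume.withDensity fun x => ‖ψ x‖ₑ ^ 2 := by
  ext B hB
  have hψ' : ‖ψ‖ₑ = 1 := by rw [← ofReal_norm, hψ, ENNReal.ofReal_one]
  rw [withDensity_apply _ hB, ← self_comp_adjoint_rankOne hψ, energyDist_self_comp_adjoint _ hB]
  simp_rw [← enorm_energyProj_sq B hB, InnerProductSpace.rankOne_apply, map_smul, enorm_smul,
    mul_pow]
  rw [ENNReal.tsum_mul_right, tsum_enorm_inner_hilbertBasisSet, hψ', one_pow, one_mul]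

/-- Every centred Gaussian is the energy distribution of a pure weight state. -/
theorem exists_isDensityOperator_energyDist_eq_gaussianReal {v : NNReal} (hv : v ≠ 0) :
    ∃ ρ : WeightSpace →L[ℂ] WeightSpace, IsDensityOperator ρ ∧
      energyDist ρ = gaussianReal 0 v := by
  -- The wave function is the square root of the Gaussian density, which exists because the variance
  -- is nonzero.
  have hm : Measurable fun x => ((Real.sqrt (gaussianPDFReal 0 v x) : ℝ) : ℂ) := by fun_prop
  have hsq : ∀ x, ‖((Real.sqrt (gaussianPDFReal 0 v x) : ℝ) : ℂ)‖ₑ ^ 2 = gaussianPDF 0 v x := by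
    intro x
    rw [← ofReal_norm, Complex.norm_real, Real.norm_of_nonneg (Real.sqrt_nonneg _),
      ← ENNReal.ofReal_pow (Real.sqrt_nonneg _), Real.sq_sqrt (gaussianPDFReal_nonneg _ _ _)]
    rfl
  have hint : ∫⁻ x, ‖((Real.sqrt (gaussianPDFReal 0 v x) : ℝ) : ℂ)‖ₑ ^ 2 = 1 := by
    simp_rw [hsq]
    exact lintegral_gaussianPDF_eq_one 0 hv
  have hnorm : eLpNorm (fun x => ((Real.sqrt (gaussianPDFReal 0 v x) : ℝ) : ℂ)) 2 volume = 1 := by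
    rw [eLpNorm_eq_lintegral_rpow_enorm_toReal (by norm_num) (by norm_num)]
    simp only [ENNReal.toReal_ofNat, ENNReal.rpow_ofNat]
    rw [hint, ENNReal.one_rpow]
  have hL : MemLp (fun x => ((Real.sqrt (gaussianPDFReal 0 v x) : ℝ) : ℂ)) 2 volume :=
    ⟨hm.aestronglyMeasurable, by rw [hnorm]; exact ENNReal.one_lt_top⟩
  have hψ : ‖hL.toLp _‖ = 1 := by rw [Lp.norm_toLp, hnorm, ENNReal.toReal_one]
  refine ⟨_, isDensityOperator_rankOne hψ, ?_⟩
  rw [energyDist_rankOne hψ, gaussianReal_of_var_ne_zero 0 hv]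
  refine withDensity_congr_ae ?_
  filter_upwards [hL.coeFn_toLp] with x hx
  rw [hx, hsq]

end PureState

/-! ### The final state of the weight -/

section Protocol

theorem displacement_coe (a : ℝ) (f : WeightSpace) :
    displacement a f =ᵐ[volume] fun x => f (x - a) :=
  Lp.coeFn_compMeasurePreserving f (measurePreserving_sub_right volume a)

theorem displacement_displacement (a b : ℝ) (f : WeightSpace) :
    displacement a (displacement b f) = displacement (a + b) f := by
  apply Lp.ext
  have h := (measurePreserving_sub_right (volume : Measure ℝ) a).quasiMeasurePreserving.ae_eq_comp
    (displacement_coe b f)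
  filter_upwards [displacement_coe a (displacement b f), displacement_coe (a + b) f, h]
    with x h1 h2 h3
  rw [h1, h2]
  simp only [Function.comp_apply] at h3
  rw [h3, sub_sub]

theorem displacement_zero (f : WeightSpace) : displacement 0 f = f := by
  apply Lp.ext
  filter_upwards [displacement_coe 0 f] with x h1
  rw [h1, sub_zero]

theorem adjoint_displacement (a : ℝ) : adjoint (displacement a) = displacement (-a) := by
  symm
  rw [ContinuousLinearMap.eq_adjoint_iff]
  intro f g
  have h : inner ℂ (displacement a (displacement (-a) f)) (displacement a g)
      = inner ℂ (displacement (-a) f) g :=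
    LinearIsometry.inner_map_map _ _ _
  rw [← h, displacement_displacement, add_neg_cancel, displacement_zero]

variable {ι : Type*} [Fintype ι] [DecidableEq ι]

theorem braOp_ketOp (i j : ι) (f : WeightSpace) :
    braOp i (ketOp j f) = if i = j then f else 0 := by
  rw [ketOp_apply, braOp]
  by_cases h : i = j
  · subst h; simp
  · simp [h]

/-- The amplitude of the final weight state belonging to the final eigenstate `i` and to the
component `x` of the initial system state. -/
noncomputable def transitionOp (ε : ι → ℝ) (V : Matrix ι ι ℂ)
    (R : WeightSpace →L[ℂ] WeightSpace) (x : ι → ℂ) (i : ι) : WeightSpace →L[ℂ] WeightSpace :=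
  ∑ j, (V i j * x j) • (displacement (ε j - ε i) ∘L R)

/-- `S` acts on `|εⱼ⟩` as `Γ_{εⱼ}`, `S†` contributes `Γ_{-εᵢ}` and `V` a scalar: the weight gains
exactly the energy that the system loses. -/
theorem braOp_protocolUnitary_ketOp (ε : ι → ℝ) (V : Matrix ι ι ℂ) (i j : ι) :
    braOp i ∘L protocolUnitary ε V ∘L ketOp j = V i j • displacement (ε j - ε i) := by
  ext1 f
  have hS : ∀ y : WeightSpace, shiftOp ε (ketOp j y) = ketOp j (displacement (ε j) y) := by
    intro y
    simp only [shiftOp, _root_.sum_apply, ContinuousLinearMap.comp_apply, braOp_ketOp]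
    rw [Finset.sum_eq_single j]
    · simp
    · intro b _ hb; simp [hb]
    · simp
  have hS' : ∀ y : JointSpace ι, braOp i (adjoint (shiftOp ε) y)
      = displacement (-ε i) (braOp i y) := by
    intro y
    simp only [shiftOp, map_sum, ContinuousLinearMap.adjoint_comp, ketOp,
      ContinuousLinearMap.adjoint_adjoint, _root_.sum_apply,
      ContinuousLinearMap.comp_apply, adjoint_displacement]
    rw [Finset.sum_eq_single i]
    · exact (braOp_ketOp i i _).trans (if_pos rfl)
    · intro b _ hb
      exact (braOp_ketOp i b _).trans (if_neg hb.symm)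
    · simp
  have hV : ∀ y : WeightSpace, braOp i (tensorOp V (ContinuousLinearMap.id ℂ WeightSpace)
      (ketOp j y)) = V i j • y := by
    intro y
    simp only [tensorOp, _root_.sum_apply, _root_.smul_apply,
      ContinuousLinearMap.comp_apply, ContinuousLinearMap.id_apply, braOp_ketOp, map_sum, map_smul]
    rw [Finset.sum_eq_single i, Finset.sum_eq_single j]
    · simp
    · intro b _ hb; simp [hb]
    · simp
    · intro b _ hb; simp [hb.symm]
    · simp
  simp only [protocolUnitary, ContinuousLinearMap.comp_apply, _root_.smul_apply]
  rw [hS, hS', hV, map_smul, displacement_displacement, neg_add_eq_sub]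

omit [DecidableEq ι] in
-- Factorises the product state through the maps `v_m ⊗ R` from the weight to the joint space.
theorem tensorOp_eq_sum {n : ℕ} {ρS : Matrix ι ι ℂ} {v : Fin n → ι → ℂ}
    (hv : ∀ j k, ρS j k = ∑ m, v m j * star (v m k)) {ρ R : WeightSpace →L[ℂ] WeightSpace}
    (hR : R ∘L adjoint R = ρ) :
    tensorOp ρS ρ = ∑ m, (∑ j, v m j • (ketOp j ∘L R)) ∘L adjoint (∑ j, v m j • (ketOp j ∘L R)) := by
  have h : ∀ c : ℂ, ∀ j : ι, adjoint (c • (ketOp j ∘L R)) = star c • (adjoint R ∘L braOp j) := by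
    intro c j
    rw [map_smulₛₗ, ContinuousLinearMap.adjoint_comp, ketOp, ContinuousLinearMap.adjoint_adjoint]
    rfl
  have h2 : ∀ m, (∑ j, v m j • (ketOp j ∘L R)) ∘L adjoint (∑ j, v m j • (ketOp j ∘L R))
      = ∑ j, ∑ k, (v m j * star (v m k)) • (ketOp j ∘L ρ ∘L braOp k) := by
    intro m
    simp only [map_sum, h, ContinuousLinearMap.finsetSum_comp]
    refine Finset.sum_congr rfl fun j _ => ?_
    simp only [ContinuousLinearMap.comp_finsetSum]
    refine Finset.sum_congr rfl fun k _ => ?_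
    rw [ContinuousLinearMap.smul_comp, ContinuousLinearMap.comp_smul, smul_smul, ← hR]
    rfl
  rw [tensorOp, Finset.sum_congr rfl fun m _ => h2 m]
  conv_rhs => rw [Finset.sum_comm]
  refine Finset.sum_congr rfl fun j _ => ?_
  conv_rhs => rw [Finset.sum_comm]
  refine Finset.sum_congr rfl fun k _ => ?_
  rw [hv]
  ext1 x
  simp only [_root_.smul_apply, _root_.sum_apply]
  exact Finset.sum_smul ..

theorem finalWeight_eq_sum {n : ℕ} (ε : ι → ℝ) (V : Matrix ι ι ℂ) {ρS : Matrix ι ι ℂ}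
    {v : Fin n → ι → ℂ} (hv : ∀ j k, ρS j k = ∑ m, v m j * star (v m k))
    {ρ R : WeightSpace →L[ℂ] WeightSpace} (hR : R ∘L adjoint R = ρ) :
    finalWeight ε V ρS ρ = ∑ p : ι × Fin n,
      transitionOp ε V R (v p.2) p.1 ∘L adjoint (transitionOp ε V R (v p.2) p.1) := by
  have h : ∀ i m, braOp i ∘L protocolUnitary ε V ∘L (∑ j, v m j • (ketOp j ∘L R))
      = transitionOp ε V R (v m) i := by
    intro i m
    simp only [ContinuousLinearMap.comp_finsetSum, ContinuousLinearMap.comp_smul, transitionOp]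
    refine Finset.sum_congr rfl fun j _ => ?_
    have := congrArg (fun T => T ∘L R) (braOp_protocolUnitary_ketOp ε V i j)
    simp only [ContinuousLinearMap.comp_assoc, ContinuousLinearMap.smul_comp] at this
    rw [this, smul_smul, mul_comm]
  rw [Fintype.sum_prod_type, finalWeight, partialTraceS]
  refine Finset.sum_congr rfl fun i _ => ?_
  rw [tensorOp_eq_sum hv hR]
  simp only [← h]
  exact comp_sum_self_comp_adjoint_comp _ _ _ _

omit [DecidableEq ι] in
theorem transitionOp_coe (ε : ι → ℝ) (V : Matrix ι ι ℂ) (R : WeightSpace →L[ℂ] WeightSpace)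
    (x : ι → ℂ) (i : ι) (f : WeightSpace) :
    transitionOp ε V R x i f
      =ᵐ[volume] fun y => ∑ j, V i j * x j * (R f : WeightSpace) (y + (ε i - ε j)) := by
  rw [transitionOp, _root_.sum_apply]
  have h1 : ∀ᵐ y, ∀ j, ((V i j * x j) • displacement (ε j - ε i) (R f) : WeightSpace) y
      = V i j * x j * (R f : WeightSpace) (y + (ε i - ε j)) := by
    rw [ae_all_iff]
    intro j
    filter_upwards [Lp.coeFn_smul (V i j * x j) (displacement (ε j - ε i) (R f)),
      displacement_coe (ε j - ε i) (R f)] with y hy1 hy2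
    rw [hy1, Pi.smul_apply, hy2, smul_eq_mul, ← sub_neg_eq_add, neg_sub]
  filter_upwards [Lp.coeFn_finsetSum Finset.univ
    (fun j => ((V i j * x j) • displacement (ε j - ε i) (R f) : WeightSpace)), h1] with y hy hy1
  simp only [_root_.smul_apply, ContinuousLinearMap.comp_apply]
  rw [hy]
  simp [hy1]

/-- The final energy distribution is the initial one convolved with the work distribution. -/
theorem energyDist_finalWeight {n : ℕ} {ε : ι → ℝ} {V : Matrix ι ι ℂ}
    (hV : V ∈ Matrix.unitaryGroup ι ℂ) {ρS : Matrix ι ι ℂ}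
    (hinc : Commute (workOp ε V) (sysHam ε) ∨ Commute ρS (sysHam ε)) {v : Fin n → ι → ℂ}
    (hv : ∀ j k, ρS j k = ∑ m, v m j * star (v m k)) {ρ : WeightSpace →L[ℂ] WeightSpace}
    (hρ : IsDensityOperator ρ) :
    energyDist (finalWeight ε V ρS ρ) = (energyDist ρ).conv
      (weightedDirac (Finset.univ ×ˢ Finset.univ.image ε)
        (fun p => transitionWeight ε V v p.1 p.2) fun p => p.2 - ε p.1) := by
  have := isProbabilityMeasure_energyDist hρ
  have hR := opSqrt_comp_adjoint hρ.isPositive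
  ext B hB
  rw [conv_weightedDirac, finalWeight_eq_sum ε V hv hR,
    energyDist_sum_self_comp_adjoint _ _ hB, Measure.coe_finsetSum, Finset.sum_apply]
  simp only [Measure.smul_apply, smul_eq_mul]
  have h1 : ∀ a : ℝ, (energyDist ρ).map (fun x => x + a) B
      = ∑' e : hilbertBasisSet WeightSpace,
          ∫⁻ x in B, ‖(opSqrt ρ (e : WeightSpace) : WeightSpace) (x - a)‖ₑ ^ 2 := by
    intro a
    rw [Measure.map_apply (by fun_prop) hB]
    conv_lhs => rw [← hR]
    rw [energyDist_self_comp_adjoint _ (hB.preimage (by fun_prop))]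
    refine tsum_congr fun e => ?_
    have := (measurePreserving_add_right (volume : Measure ℝ) a).setLIntegral_comp_preimage_emb
      (measurableEmbedding_addRight a)
      (fun x => ‖(opSqrt ρ (e : WeightSpace) : WeightSpace) (x - a)‖ₑ ^ 2) B
    simpa using this
  simp_rw [h1, ← ENNReal.tsum_mul_left]
  rw [← Summable.tsum_finsetSum fun _ _ => ENNReal.summable]
  refine tsum_congr fun e => ?_
  have hm : ∀ a : ℝ, AEMeasurable
      (fun x => ‖(opSqrt ρ (e : WeightSpace) : WeightSpace) (x - a)‖ₑ ^ 2) volume := by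
    intro a
    refine AEMeasurable.pow_const (AEStronglyMeasurable.enorm ?_) 2
    exact (Lp.aestronglyMeasurable _).comp_measurePreserving (measurePreserving_sub_right volume a)
  simp_rw [← lintegral_const_mul' _ _ ENNReal.ofReal_ne_top]
  rw [← lintegral_finsetSum' _ fun p _ => ((hm _).const_mul _).restrict]
  refine lintegral_congr_ae (ae_restrict_of_ae ?_)
  -- There are finitely many pairs (i, m), so one null set serves them all and the rest is an
  -- identity at a fixed energy y.
  have h2 : ∀ᵐ y, ∀ p : ι × Fin n,
      (transitionOp ε V (opSqrt ρ) (v p.2) p.1 (e : WeightSpace) : WeightSpace) y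
        = ∑ j, V p.1 j * v p.2 j
            * (opSqrt ρ (e : WeightSpace) : WeightSpace) (y + (ε p.1 - ε j)) :=
    ae_all_iff.2 fun p => transitionOp_coe ε V (opSqrt ρ) (v p.2) p.1 e
  filter_upwards [h2] with y hy
  simp_rw [hy]
  -- Interference cancels pointwise in y and separately for each basis vector, before any
  -- integration: `F` is the wave function `√ρ e` translated to y.
  have h3 := congrArg ENNReal.ofReal (sum_norm_sum_sq hV hinc hv
    fun t => (opSqrt ρ (e : WeightSpace) : WeightSpace) (y + t))
  rw [← Fintype.sum_prod_type' (f := fun i m => ‖∑ j, V i j * v m j *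
      (opSqrt ρ (e : WeightSpace) : WeightSpace) (y + (ε i - ε j))‖ ^ 2),
    ENNReal.ofReal_sum_of_nonneg fun _ _ => by positivity,
    ENNReal.ofReal_sum_of_nonneg fun _ _ =>
      mul_nonneg (transitionWeight_nonneg _ _ _ _ _) (by positivity)] at h3
  simp_rw [ENNReal.ofReal_mul (transitionWeight_nonneg _ _ _ _ _),
    ENNReal.ofReal_pow (norm_nonneg _), ofReal_norm] at h3
  rw [h3]
  refine Finset.sum_congr rfl fun p _ => ?_
  rw [← sub_neg_eq_add y, neg_sub]

end Protocol

/-! ### The corollary -/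

theorem mainTheorem9 {ι : Type*} [Fintype ι] [DecidableEq ι] (ε : ι → ℝ)
    (V : Matrix ι ι ℂ) (hV : V ∈ Matrix.unitaryGroup ι ℂ)
    (ρS : Matrix ι ι ℂ) (hρS : IsDensityMatrix ρS)
    (hinc : Commute (workOp ε V) (sysHam ε) ∨ Commute ρS (sysHam ε)) :
    -- the extracted work does not depend on the weight state
    (∀ ρW : WeightSpace →L[ℂ] WeightSpace, IsDensityOperator ρW →
      Integrable id (energyDist ρW) →
        Integrable id (energyDist (finalWeight ε V ρS ρW)) ∧
        workGain ε V ρS ρW = sysMean ρS (workOp ε V)) ∧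
    -- the variance gain does not depend on the weight state
    (∀ ρW : WeightSpace →L[ℂ] WeightSpace, IsDensityOperator ρW →
      MemLp id 2 (energyDist ρW) →
        MemLp id 2 (energyDist (finalWeight ε V ρS ρW)) ∧
        varianceGain ε V ρS ρW = sysVar ρS (workOp ε V)) ∧
    -- every initial dispersion is compatible with this work and variance gain
    (∀ s : ℝ, 0 < s →
      ∃ ρW : WeightSpace →L[ℂ] WeightSpace, IsDensityOperator ρW ∧
        MemLp id 2 (energyDist ρW) ∧ dispersion ρW = ENNReal.ofReal s ∧
        workGain ε V ρS ρW = sysMean ρS (workOp ε V) ∧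
        varianceGain ε V ρS ρW = sysVar ρS (workOp ε V)) ∧
    -- the final dispersion is bounded below
    (∀ ρW : WeightSpace →L[ℂ] WeightSpace, IsDensityOperator ρW →
      ENNReal.ofReal (Real.sqrt (sysVar ρS (workOp ε V))) ≤
        dispersion (finalWeight ε V ρS ρW)) := by
  classical
  obtain ⟨n, v, hv'⟩ := Matrix.posSemidef_iff_eq_sum_vecMulVec.1 hρS.posSemidef
  have hv : ∀ j k, ρS j k = ∑ m, v m j * star (v m k) := by
    intro j k
    conv_lhs => rw [hv']
    simp [Matrix.sum_apply, Matrix.vecMulVec_apply]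
  -- The work distribution; it is fixed before any weight state is chosen.
  set ν : Measure ℝ := weightedDirac (Finset.univ ×ˢ Finset.univ.image ε)
    (fun p => transitionWeight ε V v p.1 p.2) (fun p => p.2 - ε p.1) with hν
  have hw : ∀ p : ι × ℝ, 0 ≤ transitionWeight ε V v p.1 p.2 :=
    fun p => transitionWeight_nonneg _ _ _ _ _
  have hν1 : IsProbabilityMeasure ν := isProbabilityMeasure_weightedDirac _ hw <| by
    rw [sum_transitionWeight hV hinc hv, hρS.trace_eq_one, Complex.one_re]
  have hν2 : MemLp id 2 ν := memLp_id_weightedDirac _ _ _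
  have hνi : Integrable id ν := hν2.integrable one_le_two
  have hmean : ∫ x, x ∂ν = sysMean ρS (workOp ε V) :=
    (integral_weightedDirac _ hw fun x => x).trans (sum_transitionWeight_mul_work hV hinc hv)
  have hsq : ∫ x, x ^ 2 ∂ν = sysMean ρS (workOp ε V * workOp ε V) :=
    (integral_weightedDirac _ hw fun x => x ^ 2).trans
      (sum_transitionWeight_mul_work_sq hV hinc hv)
  have hvar : variance id ν = sysVar ρS (workOp ε V) := by
    rw [variance_eq_sub hν2, sysVar, ← hmean, ← hsq]
    rfl
  have hdist : ∀ ρW : WeightSpace →L[ℂ] WeightSpace, IsDensityOperator ρW →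
      energyDist (finalWeight ε V ρS ρW) = (energyDist ρW).conv ν :=
    fun ρW hρW => energyDist_finalWeight hV hinc hv hρW
  have hfirst : ∀ ρW : WeightSpace →L[ℂ] WeightSpace, IsDensityOperator ρW →
      Integrable id (energyDist ρW) →
        Integrable id (energyDist (finalWeight ε V ρS ρW)) ∧
        workGain ε V ρS ρW = sysMean ρS (workOp ε V) := by
    intro ρW hρW hint
    have := isProbabilityMeasure_energyDist hρW
    rw [workGain, meanEnergy, meanEnergy, hdist ρW hρW, integral_id_conv hint hνi, hmean,
      add_sub_cancel_left]
    exact ⟨integrable_id_conv hint hνi, rfl⟩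
  have hsecond : ∀ ρW : WeightSpace →L[ℂ] WeightSpace, IsDensityOperator ρW →
      MemLp id 2 (energyDist ρW) →
        MemLp id 2 (energyDist (finalWeight ε V ρS ρW)) ∧
        varianceGain ε V ρS ρW = sysVar ρS (workOp ε V) := by
    intro ρW hρW hL
    have := isProbabilityMeasure_energyDist hρW
    rw [varianceGain, varEnergy, varEnergy, hdist ρW hρW, variance_id_conv hL hν2, hvar,
      add_sub_cancel_left]
    exact ⟨(memLp_two_id_conv_iff hν2).2 hL, rfl⟩
  refine ⟨hfirst, hsecond, fun s hs => ?_, fun ρW hρW => ?_⟩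
  -- A pure Gaussian state of variance `s ^ 2` realises the prescribed dispersion.
  · obtain ⟨ρW, hρW, hg⟩ := exists_isDensityOperator_energyDist_eq_gaussianReal
      (v := Real.toNNReal (s ^ 2)) (by simpa using hs.ne')
    have := isProbabilityMeasure_energyDist hρW
    have hL : MemLp id 2 (energyDist ρW) := by
      rw [hg]
      exact memLp_id_gaussianReal 2
    refine ⟨ρW, hρW, hL, ?_, (hfirst ρW hρW (hL.integrable one_le_two)).2, (hsecond ρW hρW hL).2⟩
    rw [dispersion, ← hL.ofReal_variance_eq, hg, variance_id_gaussianReal,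
      Real.coe_toNNReal _ (sq_nonneg s), ENNReal.ofReal_rpow_of_nonneg (sq_nonneg s) (by norm_num),
      ← Real.sqrt_eq_rpow, Real.sqrt_sq hs.le]
  · have := isProbabilityMeasure_energyDist hρW
    -- Reading `sysVar` as the variance of `ν` supplies its nonnegativity, so that the real square
    -- root becomes the extended one.
    rw [dispersion, hdist ρW hρW, ← hvar, Real.sqrt_eq_rpow,
      ← ENNReal.ofReal_rpow_of_nonneg (variance_nonneg _ _) (by norm_num)]
    exact ENNReal.rpow_le_rpow (ofReal_variance_le_evariance_conv hν2) (by norm_num)
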